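/- Let $\mathcal X,\mathcal Y$ be finite alphabets, let $P_X$ be a probability distribution on $\mathcal X$, and let $P_{Y|X}$ be a discrete memoryless channel from $\mathcal X$ to $\mathcal Y$. A rate $R\ge 0$ is called achievable under the input distribution constraint $P_X$ if there is a sequence of stochastic encoders and stochastic decoders $(P_{X^n|M_n},P_{\widehat M_n|Y^n})_{n=1}^\infty$ with the following property: when $M_n$ is uniformly distributed on the set $[1:e^{nR}]$ of integers from $1$ to $\lfloor e^{nR}\rfloor$, $X^n$ is generated from $M_n$ by $P_{X^n|M_n}$, $Y^n$ from $X^n$ by $P_{Y|X}^n$ (that is, by $n$ memoryless uses of the channel), and $\widehat M_n$ from $Y^n$ by $P_{\widehat M_n|Y^n}$ (so that $M_n\to X^n\to Y^n\to\widehat M_n$), one has $P_{X^n}=P_X^n$ exactly for every $n$, and $\lim_{n\to\infty}\mathbb P\{M_n=\widehat M_n\}=1$. Let $$C(P_X):=\sup\{R\ge 0: R \text{ is achievable under the input distribution constraint } P_X\}$$ be the channel capacity with input distribution constraint $P_X$. Let $(X,Y)$ have joint distribution $P_XP_{Y|X}$, and let $$C_{\mathsf{GK}}(X;Y):=\sup_{f,g\,:\,f(X)=g(Y)\text{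 a.s.}}H(f(X))$$ be the Gács–Körner common information, where the supremum is over all functions $f$ on $\mathcal X$ and $g$ on $\mathcal Y$ with values in a common finite set and $H$ is the Shannon entropy in nats. Then both suprema are over non-empty sets bounded above, and $$C(P_X)=C_{\mathsf{GK}}(X;Y).$$ -/

import Mathlib

open scoped NNReal ENNReal Topology

namespace ChannelCapacity

/-- The law of independent random variables with laws `p 0, …, p (n - 1)`. -/
noncomputable def productLaw {α : Type*} [Fintype α] {n : ℕ} (p : Fin n → PMF α) :
    PMF (Fin n → α) :=
  PMF.ofFintype (fun a => ∏ i, p i (a i)) (by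
    classical
    rw [← Fintype.prod_sum (fun i x => p i x)]
    refine Finset.prod_eq_one fun i _ => ?_
    simpa only [tsum_fintype] using (p i).tsum_coe)

/-- Shannon entropy (in nats) of a law on a finite set. -/
noncomputable def entropy {α : Type*} [Fintype α] (p : PMF α) : ℝ :=
  ∑ a, Real.negMulLog (p a).toReal

/-- The joint law of channel input and channel output. -/
noncomputable def inputOutputLaw {X Y : Type*} (P : PMF X) (W : X → PMF Y) : PMF (X × Y) :=
  P.bind fun x => (W x).map fun y => (x, y)

/-- The entropies `H(f(X))`, where `f` and `g` are functions on the two alphabets (with values in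
a common finite set) such that `f(X) = g(Y)` almost surely when `(X, Y)` has law `Q`. -/
def commonPartEntropies {X Y : Type*} (Q : PMF (X × Y)) : Set ℝ :=
  {h | ∃ (k : ℕ) (f : X → Fin k) (g : Y → Fin k),
    (∀ z ∈ Q.support, f z.1 = g z.2) ∧ h = entropy (Q.map fun z => f z.1)}

/-- The Gács–Körner common information of a pair with law `Q`. -/
noncomputable def gacsKorner {X Y : Type*} (Q : PMF (X × Y)) : ℝ :=
  sSup (commonPartEntropies Q)

/-- The number of integers in `[1 : e ^ (n R)]`. -/
noncomputable def numMessages (n : ℕ) (R : ℝ≥0) : ℕ := ⌊Real.exp (n * R)⌋₊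

instance numMessages_neZero (n : ℕ) (R : ℝ≥0) : NeZero (numMessages n R) :=
  ⟨(Nat.floor_pos.2 (Real.one_le_exp (by positivity))).ne'⟩

/-- A block code of length `n` with `m` messages, with a stochastic encoder and a stochastic
decoder. -/
structure Code (X Y : Type*) (n m : ℕ) where
  encoder : Fin m → PMF (Fin n → X)
  decoder : (Fin n → Y) → PMF (Fin m)

/-- The joint law of the message (uniformly distributed), the channel input word, the channel
output word (over `n` memoryless uses of the channel `W`) and the decoded message. -/
noncomputable def Code.law {X Y : Type*} [Fintype Y] {n m : ℕ} [NeZero m] (c : Code X Y n m)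
    (W : X → PMF Y) : PMF (Fin m × (Fin n → X) × (Fin n → Y) × Fin m) :=
  (PMF.uniformOfFintype (Fin m)).bind fun s =>
    (c.encoder s).bind fun x =>
      (productLaw fun i => W (x i)).bind fun y =>
        (c.decoder y).map fun t => (s, x, y, t)

/-- The law of the channel input word. -/
noncomputable def Code.inputLaw {X Y : Type*} [Fintype Y] {n m : ℕ} [NeZero m] (c : Code X Y n m)
    (W : X → PMF Y) : PMF (Fin n → X) :=
  (c.law W).map fun ω => ω.2.1

/-- The probability that the decoded message is the message sent. -/
noncomputable def Code.successProb {X Y : Type*} [Fintype Y] {n m : ℕ} [NeZero m]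
    (c : Code X Y n m) (W : X → PMF Y) : ℝ≥0∞ :=
  (c.law W).toOuterMeasure {ω | ω.1 = ω.2.2.2}

/-- The rate `R` is achievable: some sequence of codes with messages uniform on `[1 : e ^ (n R)]`
has channel input exactly i.i.d. with law `P`, and probability of correct decoding tending to 1.
(Block length `0`, where there is a single message and a single input word, imposes nothing.) -/
def Achievable {X Y : Type*} [Fintype X] [Fintype Y] (P : PMF X) (W : X → PMF Y) (R : ℝ≥0) :
    Prop :=
  ∃ c : ∀ n : ℕ, Code X Y n (numMessages n R),
    (∀ n, (c n).inputLaw W = productLaw fun _ => P) ∧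
      Filter.Tendsto (fun n => (c n).successProb W) Filter.atTop (𝓝 1)

/-- The set of achievable rates. -/
def achievableRates {X Y : Type*} [Fintype X] [Fintype Y] (P : PMF X) (W : X → PMF Y) : Set ℝ :=
  {r | ∃ R : ℝ≥0, (R : ℝ) = r ∧ Achievable P W R}

/-- The capacity of the memoryless channel `W` with input distribution constraint `P`. -/
noncomputable def capacity {X Y : Type*} [Fintype X] [Fintype Y] (P : PMF X) (W : X → PMF Y) : ℝ :=
  sSup (achievableRates P W)

end ChannelCapacity

/-! Let K be the maximal common part of X and Y: a function of X that almost surely is also a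
function of Y, through which all other such functions factor. Both inequalities compare rates with
H(K).

Converse. Put D(a) = E[a(X)²], S(a) = E[E[a(X)|Y]²], Q(a) = E[E[a(X)|K]²]. D - S vanishes only on
functions of X that are determined by Y, hence by K, and there D - Q vanishes too; so S ≤ cD +
(1-c)Q with some c < 1 (`exists_gram_le`). This bound tensorizes with the same c
(`posSemidef_tensorPow_bound`). Since the input is exactly i.i.d., it applies to the posteriors
a_s(x) = P(M=s|Xⁿ=x) and, through 2uv ≤ u² + v², gives 2 P(correct) ≤ 1 + c + (1-c) Σ_s
E[P(M=s|Kⁿ)²]. The last sum decays exponentially when R > H(K) (`sum_sq_div_le_rpow`), so the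
success probability cannot tend to 1.

Achievability. Both ends know Kⁿ. If R < H(K), a stochastic map that is deterministic off few atoms
turns Kⁿ into an exactly uniform message (`exists_uniformizing_kernel`). Running this map backwards
gives an encoder with exactly i.i.d. input; the decoder reads Kⁿ off Yⁿ. -/

namespace ChannelCapacity
open Matrix Finset

/-! ### Tensor powers of positive semidefinite matrices -/

/-- The `n`-th tensor power of a matrix. -/
def tensorPow {X : Type*} (A : Matrix X X ℝ) (n : ℕ) : Matrix (Fin n → X) (Fin n → X) ℝ :=
  Matrix.of fun x x' => ∏ i, A (x i) (x' i)

theorem tensorPow_succ {X : Type*} (A : Matrix X X ℝ) (n : ℕ) :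
    tensorPow A (n + 1) = (kroneckerMap (· * ·) A (tensorPow A n)).submatrix
      (fun x : Fin (n + 1) → X => (x 0, Fin.tail x)) (fun x => (x 0, Fin.tail x)) := by
  ext x x'
  simp [tensorPow, Fin.prod_univ_succ, Fin.tail]

theorem tensorPow_zero_eq {X : Type*} (A B : Matrix X X ℝ) : tensorPow A 0 = tensorPow B 0 := by
  ext x x'
  simp [tensorPow]

theorem posSemidef_tensorPow {X : Type*} [Fintype X] {A : Matrix X X ℝ} (hA : A.PosSemidef)
    (n : ℕ) : (tensorPow A n).PosSemidef := by
  classical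
  induction n with
  | zero =>
    have : tensorPow A 0 = 1 := by
      ext x x'
      rw [Subsingleton.elim x x', one_apply_eq]
      simp [tensorPow]
    rw [this]
    exact PosSemidef.one
  | succ n ih =>
    rw [tensorPow_succ]
    exact (hA.kronecker ih).submatrix _

/-- Telescoping: D⊗Dₙ - Q⊗Qₙ = (D-Q)⊗Dₙ + Q⊗(Dₙ-Qₙ), and Kronecker products preserve positivity. -/
theorem posSemidef_tensorPow_sub {X : Type*} [Fintype X] {D Q : Matrix X X ℝ}
    (hD : D.PosSemidef) (hQ : Q.PosSemidef) (hDQ : (D - Q).PosSemidef) (n : ℕ) :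
    (tensorPow D n - tensorPow Q n).PosSemidef := by
  induction n with
  | zero =>
    rw [tensorPow_zero_eq D Q, sub_self]
    exact PosSemidef.zero
  | succ n ih =>
    have key : tensorPow D (n + 1) - tensorPow Q (n + 1) =
        (kroneckerMap (· * ·) (D - Q) (tensorPow D n) +
          kroneckerMap (· * ·) Q (tensorPow D n - tensorPow Q n)).submatrix
        (fun x : Fin (n + 1) → X => (x 0, Fin.tail x)) (fun x => (x 0, Fin.tail x)) := by
      rw [tensorPow_succ, tensorPow_succ]
      ext x x'
      simp only [Matrix.sub_apply, Matrix.add_apply, submatrix_apply, kroneckerMap_apply]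
      ring
    rw [key]
    exact ((hDQ.kronecker (posSemidef_tensorPow hD n)).add (hQ.kronecker ih)).submatrix _

/-- If `S ≤ c D + (1 - c) Q` in the Loewner order, where `0 ≤ S` and `0 ≤ Q ≤ D`, then the same
bound, with the same `c`, holds for all tensor powers. -/
theorem posSemidef_tensorPow_bound {X : Type*} [Fintype X] {D Q S : Matrix X X ℝ} {c : ℝ}
    (hc : 0 ≤ c) (hc1 : c ≤ 1) (hD : D.PosSemidef) (hQ : Q.PosSemidef) (hS : S.PosSemidef)
    (hDQ : (D - Q).PosSemidef) (hb : (c • D + (1 - c) • Q - S).PosSemidef) (n : ℕ) :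
    (c • tensorPow D n + (1 - c) • tensorPow Q n - tensorPow S n).PosSemidef := by
  have hc2 : 0 ≤ 1 - c := sub_nonneg.2 hc1
  induction n with
  | zero =>
    rw [tensorPow_zero_eq Q D, tensorPow_zero_eq S D, ← add_smul, add_sub_cancel, one_smul,
      sub_self]
    exact PosSemidef.zero
  | succ n ih =>
    -- The first three terms sum to (cD+(1-c)Q)⊗(cDₙ+(1-c)Qₙ) - S⊗Sₙ. The last, positive because Q ≤
    -- D, turns that product of mixtures into the mixture of the products, so c does not
    -- deteriorate.
    have key : c • tensorPow D (n + 1) + (1 - c) • tensorPow Q (n + 1) - tensorPow S (n + 1) =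
        (kroneckerMap (· * ·) (c • D + (1 - c) • Q - S) (tensorPow S n) +
          c • kroneckerMap (· * ·) D
            (c • tensorPow D n + (1 - c) • tensorPow Q n - tensorPow S n) +
          (1 - c) • kroneckerMap (· * ·) Q
            (c • tensorPow D n + (1 - c) • tensorPow Q n - tensorPow S n) +
          (c * (1 - c)) • kroneckerMap (· * ·) (D - Q) (tensorPow D n - tensorPow Q n)).submatrix
        (fun x : Fin (n + 1) → X => (x 0, Fin.tail x)) (fun x => (x 0, Fin.tail x)) := by
      rw [tensorPow_succ, tensorPow_succ, tensorPow_succ]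
      ext x x'
      simp only [Matrix.sub_apply, Matrix.add_apply, submatrix_apply, kroneckerMap_apply, Matrix.smul_apply,
        smul_eq_mul]
      ring
    rw [key]
    exact ((((hb.kronecker (posSemidef_tensorPow hS n)).add ((hD.kronecker ih).smul hc)).add
      ((hQ.kronecker ih).smul hc2)).add
      ((hDQ.kronecker (posSemidef_tensorPow_sub hD hQ hDQ n)).smul
        (mul_nonneg hc hc2))).submatrix _

/-! ### Conditional second moments -/

/-- The matrix of the quadratic form `a ↦ E[E[a(X) | Z] ^ 2]`, where `j` is the joint law of `X`
and `Z`. -/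
noncomputable def gram {X Z : Type*} [Fintype X] [Fintype Z] (j : X → Z → ℝ) : Matrix X X ℝ :=
  Matrix.of fun x x' => ∑ z, j x z * j x' z / ∑ t, j t z

/-- The joint law of `n` independent copies. -/
def wordLaw {X Z : Type*} (j : X → Z → ℝ) (n : ℕ) (x : Fin n → X) (z : Fin n → Z) : ℝ :=
  ∏ i, j (x i) (z i)

theorem sum_wordLaw_left {X Z : Type*} [Fintype X] (j : X → Z → ℝ) (n : ℕ) (z : Fin n → Z) :
    ∑ x, wordLaw j n x z = ∏ i, ∑ x, j x (z i) := by
  classical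
  simp only [wordLaw]
  rw [← Fintype.prod_sum (fun i x => j x (z i))]

theorem sum_wordLaw_right {X Z : Type*} [Fintype Z] (j : X → Z → ℝ) (n : ℕ) (x : Fin n → X) :
    ∑ z, wordLaw j n x z = ∏ i, ∑ z, j (x i) z := by
  classical
  simp only [wordLaw]
  rw [← Fintype.prod_sum (fun i z => j (x i) z)]

theorem tensorPow_diagonal {X : Type*} [DecidableEq X] (d : X → ℝ) (n : ℕ) :
    tensorPow (diagonal d) n = diagonal fun x => ∏ i, d (x i) := by
  ext x x'
  by_cases h : x = x'
  · simp [tensorPow, h]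
  · obtain ⟨i, hi⟩ := Function.ne_iff.1 h
    rw [diagonal_apply_ne _ h]
    exact prod_eq_zero (mem_univ i) (diagonal_apply_ne _ hi)

theorem posSemidef_of_nonneg {X : Type*} [Fintype X] {M : Matrix X X ℝ} (hM : M.IsHermitian)
    (h : ∀ a : X → ℝ, 0 ≤ a ⬝ᵥ M *ᵥ a) : M.PosSemidef :=
  PosSemidef.of_dotProduct_mulVec_nonneg hM fun a => by simpa using h a

section gram

variable {X Z : Type*} [Fintype X] [Fintype Z] (j : X → Z → ℝ)

theorem tensorPow_gram (n : ℕ) : tensorPow (gram j) n = gram (wordLaw j n) := by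
  classical
  ext x x'
  simp only [tensorPow, gram, of_apply, sum_wordLaw_left]
  rw [Fintype.prod_sum (fun i z => j (x i) z * j (x' i) z / ∑ t, j t z)]
  simp only [wordLaw, prod_div_distrib, prod_mul_distrib]

theorem gram_isHermitian : (gram j).IsHermitian := by
  ext x x'
  simp [gram, mul_comm]

theorem dotProduct_gram (a : X → ℝ) :
    a ⬝ᵥ gram j *ᵥ a = ∑ z, (∑ x, j x z * a x) ^ 2 / ∑ t, j t z := by
  simp only [dotProduct, mulVec, gram, of_apply, sum_mul, mul_sum, sq, sum_div]
  rw [sum_comm' (t' := univ) (s' := fun _ => univ) (by simp)]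
  rw [sum_comm]
  conv_rhs => rw [sum_comm]
  refine sum_congr rfl fun x _ => ?_
  rw [sum_comm]
  refine sum_congr rfl fun x' _ => sum_congr rfl fun z _ => ?_
  ring

theorem dotProduct_diagonal_mulVec [DecidableEq X] (d a : X → ℝ) :
    a ⬝ᵥ diagonal d *ᵥ a = ∑ x, d x * a x ^ 2 := by
  simp only [dotProduct, mulVec_diagonal]
  exact sum_congr rfl fun x _ => by ring

variable {j}

theorem posSemidef_gram (hj : ∀ x z, 0 ≤ j x z) : (gram j).PosSemidef := by
  refine posSemidef_of_nonneg (gram_isHermitian j) fun a => ?_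
  rw [dotProduct_gram]
  exact sum_nonneg fun z _ => div_nonneg (sq_nonneg _) (sum_nonneg fun t _ => hj t z)

/-- Pythagoras for conditional expectation: E[a²] - E[E[a|Z]²] = E[(a - E[a|Z])²]. -/
theorem diagonal_sub_gram [DecidableEq X] (hj : ∀ x z, 0 ≤ j x z) (a : X → ℝ) :
    a ⬝ᵥ (diagonal fun x => ∑ z, j x z) *ᵥ a - a ⬝ᵥ gram j *ᵥ a =
      ∑ x, ∑ z, j x z * (a x - (∑ t, j t z * a t) / ∑ t, j t z) ^ 2 := by
  rw [dotProduct_gram, dotProduct_diagonal_mulVec]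
  simp only [sum_mul]
  rw [sum_comm, ← sum_sub_distrib]
  conv_rhs => rw [sum_comm]
  refine sum_congr rfl fun z _ => ?_
  by_cases hr : ∑ t, j t z = 0
  · have h0 : ∀ t, j t z = 0 := fun t =>
      (sum_eq_zero_iff_of_nonneg fun t _ => hj t z).1 hr t (mem_univ t)
    simp [h0]
  · set r := ∑ t, j t z with hrdef
    set s := ∑ t, j t z * a t with hs
    have : ∀ x, j x z * (a x - s / r) ^ 2 =
        j x z * a x ^ 2 - 2 * (s / r) * (j x z * a x) + (s / r) ^ 2 * j x z := fun x => by ring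
    simp only [this, sum_add_distrib, sum_sub_distrib, ← mul_sum]
    rw [← hrdef, ← hs]
    field_simp
    ring

theorem posSemidef_diagonal_sub_gram [DecidableEq X] (hj : ∀ x z, 0 ≤ j x z) :
    ((diagonal fun x => ∑ z, j x z) - gram j).PosSemidef := by
  refine posSemidef_of_nonneg
    ((isHermitian_diagonal _).sub (gram_isHermitian j)) fun a => ?_
  rw [sub_mulVec, dotProduct_sub, diagonal_sub_gram hj]
  exact sum_nonneg fun x _ => sum_nonneg fun z _ => mul_nonneg (hj x z) (sq_nonneg _)

/-- `2 E[a(X) d(Z)] ≤ E[E[a(X) | Z] ^ 2] + E[d(Z) ^ 2]`. -/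
theorem two_mul_sum_le_gram (hj : ∀ x z, 0 ≤ j x z) (a : X → ℝ) (d : Z → ℝ) :
    2 * ∑ x, ∑ z, j x z * a x * d z ≤
      a ⬝ᵥ gram j *ᵥ a + ∑ z, (∑ x, j x z) * d z ^ 2 := by
  rw [dotProduct_gram, sum_comm, mul_sum, ← sum_add_distrib]
  refine sum_le_sum fun z _ => ?_
  rw [← sum_mul]
  by_cases hr : ∑ t, j t z = 0
  · have h0 : ∀ t, j t z = 0 := fun t =>
      (sum_eq_zero_iff_of_nonneg fun t _ => hj t z).1 hr t (mem_univ t)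
    simp [h0]
  · set r := ∑ t, j t z with hrdef
    set s := ∑ t, j t z * a t with hs
    have hr0 : 0 < r := lt_of_le_of_ne (sum_nonneg fun t _ => hj t z) (Ne.symm hr)
    have : s ^ 2 / r + r * d z ^ 2 - 2 * (s * d z) = (s - r * d z) ^ 2 / r := by
      field_simp
      ring
    have h2 : 0 ≤ (s - r * d z) ^ 2 / r := by positivity
    linarith

end gram

/-! ### A bound between quadratic forms from an inclusion of kernels -/

/-- The inclusion of kernels lets B factor as L ∘ A. L is extended from the range of A to the
finite-dimensional space E, where it is bounded; K = ‖L‖². -/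
theorem exists_norm_sq_le_of_ker_le {V E F : Type*} [AddCommGroup V] [Module ℝ V]
    [NormedAddCommGroup E] [NormedSpace ℝ E] [FiniteDimensional ℝ E]
    [NormedAddCommGroup F] [NormedSpace ℝ F]
    (A : V →ₗ[ℝ] E) (B : V →ₗ[ℝ] F) (h : LinearMap.ker A ≤ LinearMap.ker B) :
    ∃ K : ℝ, 0 ≤ K ∧ ∀ v, ‖B v‖ ^ 2 ≤ K * ‖A v‖ ^ 2 := by
  let g : LinearMap.range A →ₗ[ℝ] F :=
    (LinearMap.ker A).liftQ B h ∘ₗ A.quotKerEquivRange.symm.toLinearMap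
  obtain ⟨L, hL⟩ := LinearMap.exists_extend g
  have hLA : ∀ v, L (A v) = B v := fun v => by
    have h1 : L (A v) = g ⟨A v, LinearMap.mem_range_self A v⟩ := by rw [← hL]; rfl
    have h2 : A.quotKerEquivRange.symm ⟨A v, LinearMap.mem_range_self A v⟩ =
        (LinearMap.ker A).mkQ v := by
      rw [LinearEquiv.symm_apply_eq]; rfl
    rw [h1]
    simp only [g, LinearMap.comp_apply, LinearEquiv.coe_coe, h2]
    exact Submodule.liftQ_apply _ _ _
  refine ⟨‖LinearMap.toContinuousLinearMap L‖ ^ 2, sq_nonneg _, fun v => ?_⟩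
  rw [← mul_pow, ← hLA]
  exact pow_le_pow_left₀ (norm_nonneg _) ((LinearMap.toContinuousLinearMap L).le_opNorm (A v)) 2

end ChannelCapacity

namespace ChannelCapacity
open Matrix Finset

/-- The map `a ↦ a(X) - E[a(X) | Z]` into `L²`, where `j` is the joint law of `X` and `Z`. -/
noncomputable def residual {X Z : Type*} [Fintype X] [Fintype Z] (j : X → Z → ℝ) :
    (X → ℝ) →ₗ[ℝ] EuclideanSpace ℝ (X × Z) where
  toFun a := WithLp.toLp 2 fun p => √(j p.1 p.2) *
    (a p.1 - (∑ t, j t p.2 * a t) / ∑ t, j t p.2)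
  map_add' a b := by
    ext p
    simp only [Pi.add_apply, mul_add, sum_add_distrib, PiLp.add_apply]
    ring
  map_smul' r a := by
    ext p
    simp only [Pi.smul_apply, smul_eq_mul, PiLp.smul_apply, RingHom.id_apply,
      mul_left_comm _ r, ← mul_sum]
    ring

theorem norm_residual_sq {X Z : Type*} [Fintype X] [Fintype Z] [DecidableEq X] {j : X → Z → ℝ}
    (hj : ∀ x z, 0 ≤ j x z) (a : X → ℝ) :
    ‖residual j a‖ ^ 2 =
      a ⬝ᵥ (diagonal fun x => ∑ z, j x z) *ᵥ a - a ⬝ᵥ gram j *ᵥ a := by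
  rw [diagonal_sub_gram hj, EuclideanSpace.norm_sq_eq, Fintype.sum_prod_type]
  refine sum_congr rfl fun x _ => sum_congr rfl fun z _ => ?_
  simp [residual, mul_pow, Real.sq_sqrt (hj x z)]

theorem mem_ker_residual {X Z : Type*} [Fintype X] [Fintype Z] {j : X → Z → ℝ}
    (hj : ∀ x z, 0 ≤ j x z) (a : X → ℝ) :
    a ∈ LinearMap.ker (residual j) ↔
      ∀ x z, j x z ≠ 0 → a x = (∑ t, j t z * a t) / ∑ t, j t z := by
  rw [LinearMap.mem_ker]
  constructor
  · intro h x z hxz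
    have h1 := congrArg (fun v : EuclideanSpace ℝ (X × Z) => v (x, z)) h
    simp only [residual, LinearMap.coe_mk, AddHom.coe_mk, PiLp.zero_apply, mul_eq_zero,
      Real.sqrt_eq_zero (hj x z), hxz, false_or] at h1
    linarith
  · intro h
    ext p
    simp only [residual, LinearMap.coe_mk, AddHom.coe_mk, PiLp.zero_apply, mul_eq_zero,
      Real.sqrt_eq_zero (hj p.1 p.2)]
    by_cases hp : j p.1 p.2 = 0
    · exact Or.inl hp
    · exact Or.inr (sub_eq_zero.2 (h _ _ hp))

/-- A function in the kernel of the residual for Y satisfies a(X) = E[a(X)|Y], so by `hconn` it is a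
function of the common part and lies in the kernel of the residual for K. The kernel inclusion
yields D - Q ≤ C(D - S), which rearranges to the claim. -/
theorem exists_gram_le {X Y K : Type*} [Fintype X] [Fintype Y] [Fintype K] [DecidableEq X]
    {j : X → Y → ℝ} {l : X → K → ℝ} (hj : ∀ x y, 0 ≤ j x y) (hl : ∀ x k, 0 ≤ l x k)
    (hm : ∀ x, ∑ k, l x k = ∑ y, j x y)
    (hconn : ∀ (a : X → ℝ) (u : Y → ℝ), (∀ x y, j x y ≠ 0 → a x = u y) →
      ∃ h : K → ℝ, ∀ x k, l x k ≠ 0 → a x = h k) :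
    ∃ c : ℝ, 0 ≤ c ∧ c < 1 ∧
      (c • (diagonal fun x => ∑ y, j x y) + (1 - c) • gram l - gram j).PosSemidef := by
  have hker : LinearMap.ker (residual j) ≤ LinearMap.ker (residual l) := by
    intro a ha
    rw [mem_ker_residual hj] at ha
    obtain ⟨h, hh⟩ := hconn a _ ha
    rw [mem_ker_residual hl]
    intro x k hxk
    have h1 : ∀ t, l t k * a t = l t k * h k := fun t => by
      by_cases ht : l t k = 0
      · simp [ht]
      · rw [hh t k ht]
    have h2 : ∑ t, l t k ≠ 0 := fun h0 =>
      hxk ((sum_eq_zero_iff_of_nonneg fun t _ => hl t k).1 h0 x (mem_univ x))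
    rw [sum_congr rfl fun t _ => h1 t, ← sum_mul, mul_div_cancel_left₀ _ h2]
    exact hh x k hxk
  obtain ⟨C, hC, hCle⟩ := exists_norm_sq_le_of_ker_le _ _ hker
  have hC1 : 0 < C + 1 := by linarith
  -- C may be 0; enlarging it to C + 1 ≥ 1 keeps the bound and puts c in [0, 1).
  refine ⟨1 - (C + 1)⁻¹, sub_nonneg.2 (inv_le_one_of_one_le₀ (by linarith)),
    sub_lt_self _ (inv_pos.2 hC1), posSemidef_of_nonneg ?_ fun a => ?_⟩
  · refine IsHermitian.sub (IsHermitian.add ?_ ?_) (gram_isHermitian j)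
    · exact (isHermitian_diagonal _).smul (IsSelfAdjoint.all _)
    · exact (gram_isHermitian l).smul (IsSelfAdjoint.all _)
  · have h := hCle a
    rw [norm_residual_sq hj, norm_residual_sq hl] at h
    simp only [hm] at h
    rw [sub_mulVec, add_mulVec, smul_mulVec, smul_mulVec, dotProduct_sub, dotProduct_add,
      dotProduct_smul, dotProduct_smul, smul_eq_mul, smul_eq_mul]
    have h0 : 0 ≤ a ⬝ᵥ (diagonal fun x => ∑ y, j x y) *ᵥ a - a ⬝ᵥ gram j *ᵥ a := by
      rw [← norm_residual_sq hj]
      exact sq_nonneg _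
    generalize a ⬝ᵥ (diagonal fun x => ∑ y, j x y) *ᵥ a = D at h h0 ⊢
    generalize a ⬝ᵥ gram j *ᵥ a = S at h h0 ⊢
    generalize a ⬝ᵥ gram l *ᵥ a = Q at h ⊢
    have h2 : (C + 1)⁻¹ * (D - Q) ≤ D - S := by
      rw [inv_mul_le_iff₀ hC1]
      linarith
    linarith

/-! ### Bounds on guessing the message from words of length n -/

/-- The probability of a correct guess is bounded in terms of the conditional laws of the message
given the common part. -/
theorem two_mul_sum_correct_le {X Y K : Type*} [Fintype X] [Fintype Y] [Fintype K]
    [DecidableEq X]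
    {j : X → Y → ℝ} {l : X → K → ℝ} (hj : ∀ x y, 0 ≤ j x y) (hl : ∀ x k, 0 ≤ l x k)
    (hm : ∀ x, ∑ k, l x k = ∑ y, j x y) (hsum : ∑ x, ∑ y, j x y = 1) {c : ℝ} (hc : 0 ≤ c)
    (hc1 : c ≤ 1)
    (hb : (c • (diagonal fun x => ∑ y, j x y) + (1 - c) • gram l - gram j).PosSemidef)
    {M : Type*} [Fintype M] (n : ℕ) (a : M → (Fin n → X) → ℝ) (d : M → (Fin n → Y) → ℝ)
    (ha : ∀ s x, 0 ≤ a s x) (ha1 : ∀ x, ∑ s, a s x ≤ 1)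
    (hd : ∀ s y, 0 ≤ d s y) (hd1 : ∀ y, ∑ s, d s y ≤ 1) :
    2 * ∑ s, ∑ x, ∑ y, wordLaw j n x y * a s x * d s y ≤ 1 + c +
      (1 - c) * ∑ κ, ∑ s, (∑ x, wordLaw l n x κ * a s x) ^ 2 / ∑ x, wordLaw l n x κ := by
  have hjn : ∀ x y, 0 ≤ wordLaw j n x y := fun x y => prod_nonneg fun i _ => hj _ _
  have sq_le : ∀ r : ℝ, 0 ≤ r → r ≤ 1 → r ^ 2 ≤ r := fun r h0 h1 => by nlinarith
  have ha2 : ∀ s x, a s x ≤ 1 := fun s x =>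
    (single_le_sum (f := fun s => a s x) (fun s _ => ha s x) (mem_univ s)).trans (ha1 x)
  have hd2 : ∀ s y, d s y ≤ 1 := fun s y =>
    (single_le_sum (f := fun s => d s y) (fun s _ => hd s y) (mem_univ s)).trans (hd1 y)
  have hone : ∑ x : Fin n → X, ∏ i, ∑ y, j (x i) y = 1 := by
    rw [← Fintype.prod_sum (fun (_ : Fin n) x => ∑ y, j x y)]
    simp [hsum]
  -- The tensorized bound evaluated at `a s`; a² ≤ a makes the D-term linear, so that it sums to at
  -- most c over the messages.
  have key : ∀ s, a s ⬝ᵥ gram (wordLaw j n) *ᵥ a s ≤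
      c * (∑ x, (∏ i, ∑ y, j (x i) y) * a s x) +
        (1 - c) * ∑ κ, (∑ x, wordLaw l n x κ * a s x) ^ 2 / ∑ x, wordLaw l n x κ := by
    intro s
    have hDQ := posSemidef_diagonal_sub_gram hl
    simp only [hm] at hDQ
    have h := (posSemidef_tensorPow_bound hc hc1
      (PosSemidef.diagonal fun x => sum_nonneg fun y _ => hj x y)
      (posSemidef_gram hl) (posSemidef_gram hj) hDQ hb n).dotProduct_mulVec_nonneg (a s)
    rw [tensorPow_diagonal, tensorPow_gram, tensorPow_gram, star_trivial, sub_mulVec, add_mulVec,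
      smul_mulVec, smul_mulVec, dotProduct_sub, dotProduct_add, dotProduct_smul,
      dotProduct_smul, dotProduct_diagonal_mulVec, dotProduct_gram (wordLaw l n), smul_eq_mul,
      smul_eq_mul] at h
    have h2 : ∑ x, (∏ i, ∑ y, j (x i) y) * a s x ^ 2 ≤ ∑ x, (∏ i, ∑ y, j (x i) y) * a s x :=
      sum_le_sum fun x _ => mul_le_mul_of_nonneg_left (sq_le _ (ha s x) (ha2 s x))
        (prod_nonneg fun i _ => sum_nonneg fun y _ => hj _ _)
    have h3 := mul_le_mul_of_nonneg_left h2 hc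
    linarith
  have hA : ∑ s, ∑ x, (∏ i, ∑ y, j (x i) y) * a s x ≤ 1 := by
    rw [sum_comm, ← hone]
    refine sum_le_sum fun x _ => ?_
    rw [← mul_sum]
    exact mul_le_of_le_one_right (prod_nonneg fun i _ => sum_nonneg fun y _ => hj _ _) (ha1 x)
  have hD : ∑ s, ∑ y, (∑ x, wordLaw j n x y) * d s y ^ 2 ≤ 1 := by
    have : ∑ y, ∑ x, wordLaw j n x y = 1 := by
      rw [sum_comm, ← hone]
      exact sum_congr rfl fun x _ => sum_wordLaw_right j n x
    rw [sum_comm, ← this]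
    refine sum_le_sum fun y _ => ?_
    rw [← mul_sum]
    refine mul_le_of_le_one_right (sum_nonneg fun x _ => hjn x y)
      ((sum_le_sum fun s _ => sq_le _ (hd s y) (hd2 s y)).trans (hd1 y))
  rw [mul_sum]
  calc _ ≤ ∑ s, (c * (∑ x, (∏ i, ∑ y, j (x i) y) * a s x) +
          (1 - c) * (∑ κ, (∑ x, wordLaw l n x κ * a s x) ^ 2 / ∑ x, wordLaw l n x κ) +
          ∑ y, (∑ x, wordLaw j n x y) * d s y ^ 2) :=
        sum_le_sum fun s _ => (two_mul_sum_le_gram hjn (a s) (d s)).trans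
          (add_le_add_left (key s) _)
    _ ≤ _ := by
      rw [sum_add_distrib, sum_add_distrib, ← mul_sum, ← mul_sum, sum_comm (s := univ (α := M))
        (f := fun s κ => (∑ x, wordLaw l n x κ * a s x) ^ 2 / ∑ x, wordLaw l n x κ)]
      have := mul_le_mul_of_nonneg_left hA hc
      linarith

/-- With p = P(κ) and b = P(s, κ), both b ≤ p and b ≤ ε hold, so b²/p ≤ b (b/p)^t ≤ b (ε/p)^t.
Summing over s leaves ε^t p^(1-t), which factorizes over the letters of κ. -/
theorem sum_sq_div_le_rpow {X K : Type*} [Fintype X] [Fintype K] {l : X → K → ℝ}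
    (hl : ∀ x k, 0 ≤ l x k) {M : Type*} [Fintype M] {n : ℕ} {a : M → (Fin n → X) → ℝ}
    (ha : ∀ s x, 0 ≤ a s x) (ha1 : ∀ x, ∑ s, a s x ≤ 1) {ε : ℝ}
    (hε1 : 0 ≤ ε) (hε : ∀ s, ∑ x, (∏ i, ∑ k, l (x i) k) * a s x ≤ ε) {t : ℝ} (ht : 0 < t) (ht1 : t < 1) :
    ∑ κ, ∑ s, (∑ x, wordLaw l n x κ * a s x) ^ 2 / ∑ x, wordLaw l n x κ ≤
      ε ^ t * (∑ k, (∑ x, l x k) ^ (1 - t)) ^ n := by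
  classical
  have hln : ∀ x κ, 0 ≤ wordLaw l n x κ := fun x y => prod_nonneg fun i _ => hl _ _
  have hp : ∀ κ, 0 ≤ ∑ x, wordLaw l n x κ := fun κ => sum_nonneg fun x _ => hln x κ
  have hb0 : ∀ s κ, 0 ≤ ∑ x, wordLaw l n x κ * a s x := fun s κ =>
    sum_nonneg fun x _ => mul_nonneg (hln x κ) (ha s x)
  have hbε : ∀ s κ, ∑ x, wordLaw l n x κ * a s x ≤ ε := fun s κ => by
    refine (sum_le_sum fun x _ => mul_le_mul_of_nonneg_right ?_ (ha s x)).trans (hε s)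
    rw [← sum_wordLaw_right]
    exact single_le_sum (fun κ _ => hln x κ) (mem_univ κ)
  have hbs : ∀ κ, ∑ s, ∑ x, wordLaw l n x κ * a s x ≤ ∑ x, wordLaw l n x κ := fun κ => by
    rw [sum_comm]
    refine sum_le_sum fun x _ => ?_
    rw [← mul_sum]
    exact mul_le_of_le_one_right (hln x κ) (ha1 x)
  have hbp : ∀ s κ, ∑ x, wordLaw l n x κ * a s x ≤ ∑ x, wordLaw l n x κ := fun s κ =>
    (single_le_sum (f := fun s => ∑ x, wordLaw l n x κ * a s x) (fun s _ => hb0 s κ)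
      (mem_univ s)).trans (hbs κ)
  have hpow : (∑ k, (∑ x, l x k) ^ (1 - t)) ^ n =
      ∑ κ : Fin n → K, (∑ x, wordLaw l n x κ) ^ (1 - t) := by
    simp only [sum_wordLaw_left]
    rw [← Fin.prod_const, Fintype.prod_sum (fun (_ : Fin n) k => (∑ x, l x k) ^ (1 - t))]
    exact sum_congr rfl fun κ _ =>
      Real.finsetProd_rpow _ _ (fun i _ => sum_nonneg fun x _ => hl _ _) _
  rw [hpow, mul_sum]
  refine sum_le_sum fun κ _ => ?_
  set p := ∑ x, wordLaw l n x κ with hpdef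
  rcases (hp κ).eq_or_lt with h0 | h0
  · rw [← hpdef] at h0
    rw [← h0, Real.zero_rpow (by linarith), mul_zero]
    simp
  have hε0 : ∀ s, (∑ x, wordLaw l n x κ * a s x) ^ 2 / p ≤
      (∑ x, wordLaw l n x κ * a s x) * (ε / p) ^ t := fun s => by
    set b := ∑ x, wordLaw l n x κ * a s x with hb
    rcases (hb0 s κ).eq_or_lt with h1 | h1
    · rw [← hb] at h1
      simp [← h1]
    rw [sq, mul_div_assoc]
    refine mul_le_mul_of_nonneg_left ?_ h1.le
    have h2 : b / p ≤ (b / p) ^ t := by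
      have := Real.rpow_le_rpow_of_exponent_ge (div_pos h1 h0) ((div_le_one h0).2 (hbp s κ)) ht1.le
      rwa [Real.rpow_one] at this
    exact h2.trans (Real.rpow_le_rpow (div_pos h1 h0).le
      (div_le_div_of_nonneg_right (hbε s κ) h0.le) ht.le)
  calc _ ≤ ∑ s, (∑ x, wordLaw l n x κ * a s x) * (ε / p) ^ t := sum_le_sum fun s _ => hε0 s
    _ ≤ p * (ε / p) ^ t := by
      rw [← sum_mul]
      exact mul_le_mul_of_nonneg_right (hbs κ) (Real.rpow_nonneg (div_nonneg hε1 h0.le) _)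
    _ = ε ^ t * p ^ (1 - t) := by
      rw [Real.div_rpow hε1 h0.le, Real.rpow_sub h0, Real.rpow_one]
      ring

end ChannelCapacity

namespace ChannelCapacity
open Finset Filter

/-! ### Power sums and entropy -/

/-- The function equals 1 at t = 0 and has slope H - R there. A small step therefore brings it below
1: to the right if R > H (converse), to the left if R < H (achievability). -/
theorem hasDerivAt_sum_rpow {K : Type*} [Fintype K] {p : K → ℝ} (hp : ∀ k, 0 ≤ p k)
    (hp1 : ∑ k, p k = 1) (R : ℝ) :
    HasDerivAt (fun t : ℝ => (∑ k, p k ^ (1 - t)) * Real.exp (-(t * R)))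
      (∑ k, Real.negMulLog (p k) - R) 0 := by
  have h1 : ∀ k, HasDerivAt (fun t : ℝ => p k ^ (1 - t)) (Real.negMulLog (p k)) 0 := by
    intro k
    rcases (hp k).eq_or_lt with h0 | h0
    · rw [← h0, Real.negMulLog_zero]
      refine (hasDerivAt_const (0 : ℝ) (0 : ℝ)).congr_of_eventuallyEq ?_
      -- A null atom contributes 0 only for t ≠ 1, since `0 ^ 0 = 1`; it suffices to stay near 0.
      filter_upwards [Iio_mem_nhds (zero_lt_one' ℝ)] with t ht
      exact Real.zero_rpow (sub_ne_zero.2 (ne_of_gt ht))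
    · have := ((hasDerivAt_id (0 : ℝ)).const_sub 1).const_rpow h0
      refine this.congr_deriv ?_
      simp [Real.negMulLog]
      ring
  have h2 : HasDerivAt (fun t : ℝ => ∑ k, p k ^ (1 - t)) (∑ k, Real.negMulLog (p k)) 0 :=
    HasDerivAt.fun_sum fun k _ => h1 k
  have h3 : HasDerivAt (fun t : ℝ => Real.exp (-(t * R))) (-R) 0 := by
    have := ((hasDerivAt_id (0 : ℝ)).mul_const R).neg.exp
    refine this.congr_deriv ?_
    simp
  refine (h2.mul h3).congr_deriv ?_
  simp [hp1]
  ring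

theorem eventually_lt_of_hasDerivAt_neg {F : ℝ → ℝ} {d : ℝ} (hF : HasDerivAt F d 0)
    (hd : d < 0) : ∀ᶠ t in 𝓝[>] 0, F t < F 0 := by
  have h := (hasDerivAt_iff_tendsto_slope.1 hF).eventually (gt_mem_nhds hd)
  have h' := nhdsWithin_mono 0 (fun t (ht : t ∈ Set.Ioi (0 : ℝ)) => ne_of_gt ht) h
  filter_upwards [h', self_mem_nhdsWithin] with t ht ht0
  rw [slope_def_field, sub_zero] at ht
  have := (div_neg_iff.1 ht).resolve_left fun h => absurd h.2 (not_lt.2 (le_of_lt ht0))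
  linarith [this.1]

theorem exists_sum_rpow_lt_of_entropy_lt {K : Type*} [Fintype K] {p : K → ℝ} (hp : ∀ k, 0 ≤ p k)
    (hp1 : ∑ k, p k = 1) {R : ℝ} (hR : ∑ k, Real.negMulLog (p k) < R) :
    ∃ t : ℝ, 0 < t ∧ t < 1 ∧ (∑ k, p k ^ (1 - t)) * Real.exp (-(t * R)) < 1 := by
  have h := eventually_lt_of_hasDerivAt_neg (hasDerivAt_sum_rpow hp hp1 R) (sub_neg.2 hR)
  obtain ⟨t, h1, h2, h3⟩ := (h.and (Eventually.and self_mem_nhdsWithin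
    (mem_nhdsWithin_of_mem_nhds (Iio_mem_nhds (zero_lt_one' ℝ))))).exists
  exact ⟨t, h2, h3, by simpa [hp1] using h1⟩

theorem exists_sum_rpow_lt_of_lt_entropy {K : Type*} [Fintype K] {p : K → ℝ} (hp : ∀ k, 0 ≤ p k)
    (hp1 : ∑ k, p k = 1) {R : ℝ} (hR : R < ∑ k, Real.negMulLog (p k)) :
    ∃ t : ℝ, 0 < t ∧ (∑ k, p k ^ (1 + t)) * Real.exp (t * R) < 1 := by
  have h0 := hasDerivAt_sum_rpow hp hp1 R
  rw [← neg_zero] at h0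
  have h := eventually_lt_of_hasDerivAt_neg (h0.comp 0 (hasDerivAt_neg 0)) (by linarith)
  obtain ⟨t, h1, h2⟩ := (h.and self_mem_nhdsWithin).exists
  exact ⟨t, h2, by simpa [hp1] using h1⟩

/-! ### The maximal common function -/

/-- There are functions `f` and `g` of channel input and channel output that agree almost surely
and of which all other such functions are functions. -/
theorem exists_maximal_common_function {X Y : Type*} [Finite X] [Finite Y] (r : X → Y → Prop) :
    ∃ (k : ℕ) (f : X → Fin k) (g : Y → Fin k), (∀ x y, r x y → f x = g y) ∧
      ∀ (a : X → ℝ) (u : Y → ℝ), (∀ x y, r x y → a x = u y) →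
        ∃ h : Fin k → ℝ, ∀ x, a x = h (f x) := by
  -- The common part is the connected component in the bipartite graph of `r`: `Quot` divides by the
  -- equivalence that `s` generates.
  let s : X ⊕ Y → X ⊕ Y → Prop := fun v w => ∃ x y, v = Sum.inl x ∧ w = Sum.inr y ∧ r x y
  obtain ⟨k, ⟨e⟩⟩ := Finite.exists_equiv_fin (Quot s)
  refine ⟨k, fun x => e (Quot.mk s (Sum.inl x)), fun y => e (Quot.mk s (Sum.inr y)), ?_, ?_⟩
  · intro x y h
    exact congrArg e (Quot.sound ⟨x, y, rfl, rfl, h⟩)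
  · intro a u h
    refine ⟨fun i => Quot.lift (Sum.elim a u) ?_ (e.symm i), fun x => ?_⟩
    · rintro _ _ ⟨x, y, rfl, rfl, hxy⟩
      exact h x y hxy
    · simp

/-! ### Laws on finite sets in terms of real numbers -/

theorem sum_toReal_eq_one {α : Type*} [Fintype α] (p : PMF α) : ∑ a, (p a).toReal = 1 := by
  rw [← ENNReal.toReal_sum fun a _ => p.apply_ne_top a, ← tsum_fintype (L := .unconditional α) (fun a => p a),
    p.tsum_coe, ENNReal.toReal_one]

theorem productLaw_apply_toReal {α : Type*} [Fintype α] {n : ℕ} (p : Fin n → PMF α)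
    (a : Fin n → α) : (productLaw p a).toReal = ∏ i, (p i (a i)).toReal := by
  simp [productLaw, ENNReal.toReal_prod]

theorem map_apply_toReal {α β : Type*} [Fintype α] [DecidableEq β] (p : PMF α) (f : α → β)
    (b : β) : (p.map f b).toReal = ∑ a, if f a = b then (p a).toReal else 0 := by
  classical
  rw [PMF.map_apply, tsum_fintype, ENNReal.toReal_sum]
  · refine sum_congr rfl fun a _ => ?_
    by_cases h : f a = b
    · simp [h]
    · simp [h, Ne.symm h]
  · intro a _
    split_ifs
    · exact p.apply_ne_top a
    · exact ENNReal.zero_ne_top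

theorem mem_support_inputOutputLaw {X Y : Type*} (P : PMF X) (W : X → PMF Y) (z : X × Y) :
    z ∈ (inputOutputLaw P W).support ↔ P z.1 ≠ 0 ∧ W z.1 z.2 ≠ 0 := by
  obtain ⟨x, y⟩ := z
  simp [inputOutputLaw, PMF.mem_support_iff, and_comm]

theorem map_inputOutputLaw {X Y Z : Type*} (P : PMF X) (W : X → PMF Y) (f : X → Z) :
    ((inputOutputLaw P W).map fun z => f z.1) = P.map f := by
  rw [inputOutputLaw, PMF.map_bind]
  simp only [PMF.map_comp]
  have : ∀ x, (W x).map ((fun z : X × Y => f z.1) ∘ fun y => (x, y)) = PMF.pure (f x) :=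
    fun x => PMF.map_const (W x) (f x)
  simp only [this]
  rfl

/-! ### Input law and success probability of a code as finite sums -/

namespace Code

theorem inputLaw_eq {X Y : Type*} [Fintype Y] {n m : ℕ} [NeZero m] (c : Code X Y n m)
    (W : X → PMF Y) : c.inputLaw W = (PMF.uniformOfFintype (Fin m)).bind c.encoder := by
  have h : ∀ (s : Fin m) (x : Fin n → X) (y : Fin n → Y), (((c.decoder y).map fun t => (s, x, y, t)).map
      fun ω => ω.2.1) = PMF.pure x := fun s x y => by
    rw [PMF.map_comp]
    exact PMF.map_const (c.decoder y) x
  simp only [inputLaw, law, PMF.map_bind, h, PMF.bind_const, PMF.bind_pure]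

theorem inputLaw_apply_toReal {X Y : Type*} [Fintype Y] {n m : ℕ} [NeZero m] (c : Code X Y n m) (W : X → PMF Y) (x : Fin n → X) :
    (c.inputLaw W x).toReal = ∑ s, (m : ℝ)⁻¹ * (c.encoder s x).toReal := by
  rw [inputLaw_eq, PMF.bind_apply, tsum_fintype, ENNReal.toReal_sum]
  · simp
  · exact fun s _ => ENNReal.mul_ne_top (PMF.apply_ne_top _ _) (PMF.apply_ne_top _ _)

theorem successProb_le_one {X Y : Type*} [Fintype Y] {n m : ℕ} [NeZero m] (c : Code X Y n m)
    (W : X → PMF Y) : c.successProb W ≤ 1 := by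
  rw [successProb, PMF.toOuterMeasure_apply, ← (c.law W).tsum_coe]
  exact ENNReal.tsum_le_tsum fun ω => Set.indicator_le_self _ _ ω

theorem successProb_toReal {X Y : Type*} [Fintype X] [Fintype Y] {n m : ℕ} [NeZero m]
    (c : Code X Y n m) (W : X → PMF Y) :
    (c.successProb W).toReal = ∑ s, ∑ x, ∑ y, (m : ℝ)⁻¹ * (c.encoder s x).toReal *
      (∏ i, (W (x i) (y i)).toReal) * (c.decoder y s).toReal := by
  classical
  have h : ∀ (s : Fin m) (x : Fin n → X) (y : Fin n → Y), ((c.decoder y).map fun t => (s, x, y, t)).toOuterMeasure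
      {ω | ω.1 = ω.2.2.2} = c.decoder y s := fun s x y => by
    rw [PMF.toOuterMeasure_map_apply, ← PMF.toOuterMeasure_apply_singleton]
    congr 1
    ext t
    simp [eq_comm]
  simp only [successProb, law, PMF.toOuterMeasure_bind_apply, h, tsum_fintype]
  have ht : ∀ s (x : Fin n → X), ∑ y, (productLaw fun i => W (x i)) y * c.decoder y s ≠ ⊤ := fun s x =>
    ENNReal.sum_ne_top.2 fun y _ => ENNReal.mul_ne_top (PMF.apply_ne_top _ _)
      (PMF.apply_ne_top _ _)
  have ht2 : ∀ s, ∑ x, c.encoder s x * ∑ y, (productLaw fun i => W (x i)) y * c.decoder y s ≠ ⊤ :=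
    fun s => ENNReal.sum_ne_top.2 fun x _ => ENNReal.mul_ne_top (PMF.apply_ne_top _ _) (ht s x)
  rw [ENNReal.toReal_sum fun s _ => ENNReal.mul_ne_top (PMF.apply_ne_top _ _) (ht2 s)]
  refine sum_congr rfl fun s _ => ?_
  rw [ENNReal.toReal_mul, ENNReal.toReal_sum fun x _ =>
    ENNReal.mul_ne_top (PMF.apply_ne_top _ _) (ht s x), mul_sum]
  refine sum_congr rfl fun x _ => ?_
  rw [ENNReal.toReal_mul, ENNReal.toReal_sum fun y _ =>
    ENNReal.mul_ne_top (PMF.apply_ne_top _ _) (PMF.apply_ne_top _ _), mul_sum, mul_sum]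
  refine sum_congr rfl fun y _ => ?_
  rw [ENNReal.toReal_mul, productLaw_apply_toReal]
  simp
  ring

end Code

end ChannelCapacity

namespace ChannelCapacity
open Finset Filter

/-! ### The converse -/

/-- Rounding down costs at most a factor 2, because e^(nR) < m + 1 ≤ 2m. -/
theorem inv_numMessages_le (n : ℕ) (R : ℝ≥0) :
    ((numMessages n R : ℕ) : ℝ)⁻¹ ≤ 2 * Real.exp (-(n * R)) := by
  have h1 : 1 ≤ Real.exp (n * R) := Real.one_le_exp (by positivity)
  have h2 : Real.exp (n * R) < numMessages n R + 1 := Nat.lt_floor_add_one _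
  have h3 : (1 : ℝ) ≤ numMessages n R :=
    Nat.one_le_cast.2 (Nat.one_le_iff_ne_zero.2 (NeZero.ne _))
  rw [Real.exp_neg, ← div_eq_mul_inv, inv_le_comm₀ (by positivity) (by positivity), inv_div,
    div_le_iff₀ two_pos]
  linarith

theorem Code.two_mul_successProb_le {X Y K : Type*} [Fintype X] [Fintype Y] [Fintype K]
    [DecidableEq X] {P : PMF X} {W : X → PMF Y} {l : X → K → ℝ} (hl : ∀ x k, 0 ≤ l x k)
    (hm : ∀ x, ∑ k, l x k = (P x).toReal) {r : ℝ} (hr : 0 ≤ r) (hr1 : r ≤ 1)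
    (hb : (r • (Matrix.diagonal fun x => ∑ y, (P x).toReal * (W x y).toReal) +
      (1 - r) • gram l - gram fun x y => (P x).toReal * (W x y).toReal).PosSemidef)
    {t : ℝ} (ht : 0 < t) (ht1 : t < 1) {n m : ℕ} [NeZero m] (c : Code X Y n m)
    (hc : c.inputLaw W = productLaw fun _ => P) :
    2 * (c.successProb W).toReal ≤
      1 + r + (1 - r) * (((m : ℝ)⁻¹) ^ t * (∑ k, (∑ x, l x k) ^ (1 - t)) ^ n) := by
  have hj : ∀ x y, 0 ≤ (P x).toReal * (W x y).toReal := fun x y => by positivity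
  have hjm : ∀ x, ∑ y, (P x).toReal * (W x y).toReal = (P x).toReal := fun x => by
    rw [← mul_sum, sum_toReal_eq_one, mul_one]
  have hin : ∀ x : Fin n → X, ∑ s, (m : ℝ)⁻¹ * (c.encoder s x).toReal =
      ∏ i, (P (x i)).toReal := fun x => by
    rw [← c.inputLaw_apply_toReal W, hc, productLaw_apply_toReal]
  have hzero : ∀ x : Fin n → X, ∏ i, (P (x i)).toReal = 0 → ∀ s,
      (m : ℝ)⁻¹ * (c.encoder s x).toReal = 0 := fun x hx s => by
    refine (sum_eq_zero_iff_of_nonneg fun s _ => ?_).1 ((hin x).trans hx) s (mem_univ s)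
    positivity
  -- The posterior of the message given the input word. On null words division by zero makes it 0,
  -- hence the total is at most 1 rather than equal to 1.
  let a : Fin m → (Fin n → X) → ℝ := fun s x =>
    (m : ℝ)⁻¹ * (c.encoder s x).toReal / ∏ i, (P (x i)).toReal
  have hPa : ∀ s x, (∏ i, (P (x i)).toReal) * a s x = (m : ℝ)⁻¹ * (c.encoder s x).toReal :=
    fun s x => by
      by_cases h : ∏ i, (P (x i)).toReal = 0
      · rw [h, hzero x h, zero_mul]
      · exact mul_div_cancel₀ _ h
  have ha : ∀ s x, 0 ≤ a s x := fun s x =>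
    div_nonneg (by positivity) (prod_nonneg fun i _ => ENNReal.toReal_nonneg)
  have ha1 : ∀ x, ∑ s, a s x ≤ 1 := fun x => by
    simp only [a, ← sum_div]
    rw [hin]
    exact div_self_le_one _
  have hε : ∀ s, ∑ x, (∏ i, ∑ k, l (x i) k) * a s x ≤ (m : ℝ)⁻¹ := fun s => by
    simp only [hm, hPa]
    rw [← mul_sum, sum_toReal_eq_one, mul_one]
  have h1 := two_mul_sum_correct_le hj hl (fun x => (hm x).trans (hjm x).symm)
    (by simp only [hjm, sum_toReal_eq_one]) hr hr1 hb n a (fun s y => (c.decoder y s).toReal)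
    ha ha1 (fun s y => ENNReal.toReal_nonneg) (fun y => (sum_toReal_eq_one _).le)
  have h2 := sum_sq_div_le_rpow hl ha ha1 (by positivity) hε ht ht1
  have h3 : (c.successProb W).toReal = ∑ s, ∑ x, ∑ y,
      wordLaw (fun x y => (P x).toReal * (W x y).toReal) n x y * a s x *
        (c.decoder y s).toReal := by
    rw [Code.successProb_toReal]
    refine sum_congr rfl fun s _ => sum_congr rfl fun x _ => sum_congr rfl fun y _ => ?_
    rw [wordLaw, prod_mul_distrib, ← hPa]
    ring
  rw [h3]
  exact h1.trans (add_le_add_right (mul_le_mul_of_nonneg_left h2 (sub_nonneg.2 hr1)) _)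

/-- For a rate above the entropy, twice the success probability would tend to 2 while its upper
bound tends to 1 + r < 2. -/
theorem Achievable.le_entropy {X Y : Type*} [Fintype X] [Fintype Y] {P : PMF X} {W : X → PMF Y}
    {R : ℝ≥0} (hR : Achievable P W R) {k : ℕ} {f : X → Fin k}
    (hf : ∀ (a : X → ℝ) (u : Y → ℝ), (∀ x y, P x ≠ 0 ∧ W x y ≠ 0 → a x = u y) →
        ∃ h : Fin k → ℝ, ∀ x, a x = h (f x)) :
    (R : ℝ) ≤ entropy (P.map f) := by
  classical
  by_contra! hlt
  let l : X → Fin k → ℝ := fun x i => if f x = i then (P x).toReal else 0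
  have hl : ∀ x i, 0 ≤ l x i := fun x i => by
    simp only [l]
    split_ifs <;> simp
  have hm : ∀ x, ∑ i, l x i = (P x).toReal := fun x => by simp [l]
  have hp : ∀ i, ∑ x, l x i = ((P.map f) i).toReal := fun i => (map_apply_toReal P f i).symm
  obtain ⟨r, hr, hr1, hb⟩ := exists_gram_le (j := fun x y => (P x).toReal * (W x y).toReal)
    (fun x y => by positivity) hl
    (fun x => by rw [hm, ← mul_sum, sum_toReal_eq_one, mul_one]) (by
      intro a u h
      obtain ⟨h', hh⟩ := hf a u fun x y hxy => h x y (mul_ne_zero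
        (ENNReal.toReal_ne_zero.2 ⟨hxy.1, PMF.apply_ne_top _ _⟩)
        (ENNReal.toReal_ne_zero.2 ⟨hxy.2, PMF.apply_ne_top _ _⟩))
      refine ⟨h', fun x i hxi => ?_⟩
      have : f x = i := by
        by_contra hne
        exact hxi (if_neg hne)
      rw [hh, this])
  obtain ⟨t, ht, ht1, hG⟩ := exists_sum_rpow_lt_of_entropy_lt
    (fun i => ENNReal.toReal_nonneg) (sum_toReal_eq_one (P.map f)) hlt
  obtain ⟨c, hc, hlim⟩ := hR
  set G := ∑ i, ((P.map f) i).toReal ^ (1 - t) with hGdef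
  have hG0 : 0 ≤ G := sum_nonneg fun i _ => Real.rpow_nonneg ENNReal.toReal_nonneg _
  have hbound : ∀ n, 2 * ((c n).successProb W).toReal ≤
      1 + r + (1 - r) * (2 ^ t * (G * Real.exp (-(t * R))) ^ n) := by
    intro n
    have h := (c n).two_mul_successProb_le hl hm hr hr1.le hb ht ht1 (hc n)
    simp only [hp] at h
    refine h.trans (add_le_add_right (mul_le_mul_of_nonneg_left ?_ (by linarith)) _)
    have h1 := Real.rpow_le_rpow (by positivity) (inv_numMessages_le n R) ht.le
    rw [Real.mul_rpow two_pos.le (Real.exp_pos _).le, ← Real.exp_mul] at h1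
    refine (mul_le_mul_of_nonneg_right h1 (pow_nonneg hG0 n)).trans_eq ?_
    rw [mul_pow, ← Real.exp_nat_mul,
      show -(n * (R : ℝ)) * t = n * (-(t * R)) by ring]
    ring
  have hlim1 : Tendsto (fun n => 2 * ((c n).successProb W).toReal) atTop (𝓝 (2 * 1)) :=
    ((ENNReal.tendsto_toReal ENNReal.one_ne_top).comp hlim).const_mul 2
  have hlim2 : Tendsto (fun n : ℕ => 1 + r + (1 - r) * (2 ^ t * (G * Real.exp (-(t * R))) ^ n))
      atTop (𝓝 (1 + r + (1 - r) * (2 ^ t * 0))) :=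
    (((tendsto_pow_atTop_nhds_zero_of_lt_one (mul_nonneg hG0 (Real.exp_pos _).le)
      hG).const_mul _).const_mul _).const_add _
  have := le_of_tendsto_of_tendsto' hlim1 hlim2 hbound
  linarith

end ChannelCapacity

namespace ChannelCapacity
open Finset Filter

/-! ### Achievability -/

/-- A transport plan between two finite measures that splits at most as many atoms of the first as
there are atoms of the second. -/
theorem exists_transport {β σ : Type*} [DecidableEq β] [DecidableEq σ] (N : ℕ) :
    ∀ (B : Finset β) (T : Finset σ) (p : β → ℝ) (q : σ → ℝ), #B + #T = N →
      (∀ k, 0 ≤ p k) → (∀ s, 0 ≤ q s) → ∑ k ∈ B, p k = ∑ s ∈ T, q s →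
      ∃ (J : β → σ → ℝ) (S : Finset β), (∀ k s, 0 ≤ J k s) ∧
        (∀ k ∈ B, ∑ s ∈ T, J k s = p k) ∧ (∀ s ∈ T, ∑ k ∈ B, J k s = q s) ∧ #S ≤ #T ∧
        ∀ k ∈ B, k ∉ S → p k = 0 ∨ ∃ s ∈ T, J k s = p k := by
  induction N with
  | zero =>
    intro B T p q hN hp hq hpq
    obtain ⟨hB, hT⟩ := Nat.add_eq_zero_iff.1 hN
    rw [card_eq_zero] at hB hT
    subst hB hT
    exact ⟨fun _ _ => 0, ∅, by simp⟩
  | succ N ih =>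
    intro B T p q hN hp hq hpq
    rcases B.eq_empty_or_nonempty with rfl | ⟨k, hk⟩
    · rw [sum_empty, eq_comm, sum_eq_zero_iff_of_nonneg fun s _ => hq s] at hpq
      exact ⟨fun _ _ => 0, ∅, by simp, by simp, fun s hs => by simp [hpq s hs], by simp, by simp⟩
    rcases T.eq_empty_or_nonempty with rfl | ⟨s, hs⟩
    · rw [sum_empty, sum_eq_zero_iff_of_nonneg fun s _ => hp s] at hpq
      exact ⟨fun _ _ => 0, ∅, by simp, fun k hk => by simp [hpq k hk], by simp, by simp,
        fun k hk _ => Or.inl (hpq k hk)⟩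
    have hBk := add_sum_erase B p hk
    have hTs := add_sum_erase T q hs
    -- Greedy filling. If atom k fits into s, it goes there whole and k is removed. Otherwise k
    -- fills s, is recorded as split in `S`, and s is removed; each split uses up one element of
    -- `T`.
    rcases le_or_gt (p k) (q s) with hle | hlt
    · obtain ⟨J, S, hJ, h1, h2, h3, h4⟩ := ih (B.erase k) T p
        (fun s' => if s' = s then q s - p k else q s')
        (by have := card_erase_add_one hk; omega) hp
        (fun s' => by
          split_ifs
          · linarith
          · exact hq s')
        (by
          rw [← add_sum_erase T _ hs, if_pos rfl,
            sum_congr rfl fun s' hs' => if_neg (ne_of_mem_erase hs')]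
          linarith)
      refine ⟨fun k' s' => if k' = k then (if s' = s then p k else 0) else J k' s', S,
        fun k' s' => ?_, fun k' hk' => ?_, fun s' hs' => ?_, h3, fun k' hk' hS => ?_⟩
      · dsimp only
        split_ifs
        exacts [hp k, le_rfl, hJ k' s']
      · by_cases h : k' = k
        · subst h
          simp [hs]
        · simp only [if_neg h]
          exact h1 k' (mem_erase.2 ⟨h, hk'⟩)
      · rw [← add_sum_erase B _ hk, sum_congr rfl fun k' hk' => if_neg (ne_of_mem_erase hk'),
          h2 s' hs']
        simp only [if_true]
        by_cases h : s' = s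
        · simp [h]
        · simp [h]
      · by_cases h : k' = k
        · exact Or.inr ⟨s, hs, by simp [h]⟩
        · simp only [if_neg h]
          exact h4 k' (mem_erase.2 ⟨h, hk'⟩) hS
    · obtain ⟨J, S, hJ, h1, h2, h3, h4⟩ := ih B (T.erase s)
        (fun k' => if k' = k then p k - q s else p k') q
        (by have := card_erase_add_one hs; omega)
        (fun k' => by
          split_ifs
          · linarith
          · exact hp k') hq
        (by
          rw [← add_sum_erase B _ hk, if_pos rfl,
            sum_congr rfl fun k' hk' => if_neg (ne_of_mem_erase hk')]
          linarith)
      refine ⟨fun k' s' => if s' = s then (if k' = k then q s else 0) else J k' s', insert k S,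
        fun k' s' => ?_, fun k' hk' => ?_, fun s' hs' => ?_, ?_, fun k' hk' hS => ?_⟩
      · dsimp only
        split_ifs
        exacts [hq s, le_rfl, hJ k' s']
      · rw [← add_sum_erase T _ hs, sum_congr rfl fun s' hs' => if_neg (ne_of_mem_erase hs'),
          h1 k' hk']
        simp only [if_true]
        by_cases h : k' = k
        · simp [h]
        · simp [h]
      · by_cases h : s' = s
        · subst h
          simp [hk]
        · simp only [if_neg h]
          exact h2 s' (mem_erase.2 ⟨h, hs'⟩)
      · have := card_insert_le k S
        have := card_erase_add_one hs
        omega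
      · rw [mem_insert, not_or] at hS
        have h5 := h4 k' hk' hS.2
        rw [if_neg hS.1] at h5
        refine h5.imp_right fun ⟨s', hs', he⟩ => ⟨s', mem_of_mem_erase hs', ?_⟩
        exact (if_neg (ne_of_mem_erase hs')).trans he

/-- A finite law is turned into the uniform law on `m` points by a stochastic map that is
deterministic at all but at most `m` atoms. -/
theorem exists_uniformizing_kernel {β : Type*} [Fintype β] {p : β → ℝ} (hp : ∀ k, 0 ≤ p k)
    (hp1 : ∑ k, p k = 1) (m : ℕ) [NeZero m] :
    ∃ (C : β → Fin m → ℝ) (δ : β → Fin m) (S : Finset β), (∀ k s, 0 ≤ C k s) ∧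
      (∀ k, ∑ s, C k s = 1) ∧ (∀ s, ∑ k, p k * C k s = (m : ℝ)⁻¹) ∧ #S ≤ m ∧
      ∀ k, k ∉ S → C k (δ k) = 1 := by
  classical
  obtain ⟨J, S, hJ, h1, h2, h3, h4⟩ := exists_transport _ (univ : Finset β)
    (univ : Finset (Fin m)) p (fun _ => (m : ℝ)⁻¹) rfl hp (fun _ => by positivity)
    (by simp [hp1, NeZero.ne m])
  have hJ0 : ∀ k, p k = 0 → ∀ s, J k s = 0 := fun k hk s =>
    (sum_eq_zero_iff_of_nonneg fun s _ => hJ k s).1 ((h1 k (mem_univ k)).trans hk) s (mem_univ s)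
  have h5 : ∀ k, ∃ s, k ∉ S → p k ≠ 0 → J k s = p k := fun k => by
    by_cases hk : k ∈ S
    · exact ⟨0, fun h => absurd hk h⟩
    · rcases h4 k (mem_univ k) hk with h | ⟨s, -, hs⟩
      · exact ⟨0, fun _ h' => absurd h h'⟩
      · exact ⟨s, fun _ _ => hs⟩
  choose δ hδ using h5
  -- The conditional law of s given k under the plan; null atoms are sent to `δ k` so that the
  -- kernel stays stochastic.
  refine ⟨fun k s => if p k = 0 then (if s = δ k then 1 else 0) else J k s / p k, δ, S,
    fun k s => ?_, fun k => ?_, fun s => ?_, by simpa using h3, fun k hk => ?_⟩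
  · beta_reduce
    split_ifs
    exacts [zero_le_one, le_rfl, div_nonneg (hJ k s) (hp k)]
  · by_cases h : p k = 0
    · simp [h]
    · simp only [if_neg h]
      rw [← sum_div, h1 k (mem_univ k), div_self h]
  · rw [← h2 s (mem_univ s)]
    refine sum_congr rfl fun k _ => ?_
    by_cases h : p k = 0
    · rw [h, zero_mul, hJ0 k h]
    · simp only [if_neg h]
      rw [mul_div_cancel₀ _ h]
  · by_cases h : p k = 0
    · simp [h]
    · simp only [if_neg h]
      rw [hδ k hk h, div_self h]

/-- Atoms of mass at most τ contribute at most τ each; a heavier one satisfies p ≤ τ^(-t) p^(1+t).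
-/
theorem sum_le_card_mul_add_rpow {β : Type*} [Fintype β] {p : β → ℝ} (hp : ∀ k, 0 ≤ p k)
    (S : Finset β) {τ t : ℝ} (hτ : 0 < τ) (ht : 0 < t) :
    ∑ k ∈ S, p k ≤ #S * τ + τ ^ (-t) * ∑ k, p k ^ (1 + t) := by
  have h : ∀ k, p k ≤ τ + τ ^ (-t) * p k ^ (1 + t) := fun k => by
    rcases le_or_gt (p k) τ with h | h
    · have : 0 ≤ τ ^ (-t) * p k ^ (1 + t) :=
        mul_nonneg (Real.rpow_nonneg hτ.le _) (Real.rpow_nonneg (hp k) _)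
      linarith
    · have h0 := hτ.trans h
      have h1 : 1 ≤ τ ^ (-t) * p k ^ t := by
        rw [Real.rpow_neg hτ.le, inv_mul_eq_div, one_le_div (Real.rpow_pos_of_pos hτ t)]
        exact Real.rpow_le_rpow hτ.le h.le ht.le
      rw [Real.rpow_add h0, Real.rpow_one]
      nlinarith
  calc _ ≤ ∑ k ∈ S, (τ + τ ^ (-t) * p k ^ (1 + t)) := sum_le_sum fun k _ => h k
    _ = #S * τ + τ ^ (-t) * ∑ k ∈ S, p k ^ (1 + t) := by
      rw [sum_add_distrib, sum_const, nsmul_eq_mul, mul_sum]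
    _ ≤ _ := by
      refine add_le_add_right (mul_le_mul_of_nonneg_left ?_ (Real.rpow_nonneg hτ.le _)) _
      exact sum_le_univ_sum_of_nonneg fun k => Real.rpow_nonneg (hp k) _

theorem exists_pmf_toReal_eq {α : Type*} [Fintype α] {w : α → ℝ} (hw : ∀ a, 0 ≤ w a)
    (hw1 : ∑ a, w a = 1) : ∃ p : PMF α, ∀ a, (p a).toReal = w a :=
  ⟨PMF.ofFintype (fun a => ENNReal.ofReal (w a)) (by
    rw [← ENNReal.ofReal_sum_of_nonneg fun a _ => hw a, hw1, ENNReal.ofReal_one]),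
    fun a => by simp [hw a]⟩

theorem sum_mul_comp_eq {α β : Type*} [Fintype α] [Fintype β] [DecidableEq β] (w : α → ℝ)
    (φ : α → β) (F : β → ℝ) :
    ∑ a, w a * F (φ a) = ∑ b, (∑ a, if φ a = b then w a else 0) * F b := by
  simp only [sum_mul, ite_mul, zero_mul]
  rw [sum_comm]
  simp

/-- Under the joint law π(x) C(f∘x, s) the message is uniform and the input i.i.d.; the encoder is
its conditional law of x given s. The decoder computes κ = g∘y = f∘x and outputs `δ κ`, which is
surely right unless κ is one of the at most m split atoms. -/
theorem exists_code_of_common_function {X Y K : Type*} [Fintype X] [Fintype Y] [Fintype K]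
    {P : PMF X} {W : X → PMF Y} {f : X → K} {g : Y → K}
    (hfg : ∀ x y, P x ≠ 0 → W x y ≠ 0 → f x = g y) (n m : ℕ) [NeZero m] {τ t : ℝ} (hτ : 0 < τ)
    (ht : 0 < t) :
    ∃ c : Code X Y n m, c.inputLaw W = productLaw (fun _ => P) ∧
      1 - (m * τ + τ ^ (-t) * (∑ k, ((P.map f) k).toReal ^ (1 + t)) ^ n) ≤
        (c.successProb W).toReal := by
  classical
  let p : (Fin n → K) → ℝ := fun κ => ∏ i, ((P.map f) (κ i)).toReal
  let π : (Fin n → X) → ℝ := fun x => ∏ i, (P (x i)).toReal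
  have hπ0 : ∀ x, 0 ≤ π x := fun x => prod_nonneg fun i _ => ENNReal.toReal_nonneg
  have hp0 : ∀ κ, 0 ≤ p κ := fun κ => prod_nonneg fun i _ => ENNReal.toReal_nonneg
  have hp1 : ∑ κ, p κ = 1 := by
    rw [← sum_toReal_eq_one (productLaw fun _ : Fin n => P.map f)]
    exact sum_congr rfl fun κ _ => (productLaw_apply_toReal _ κ).symm
  have hpπ : ∀ κ, (∑ x, if f ∘ x = κ then π x else 0) = p κ := fun κ => by
    have := sum_wordLaw_left (fun x k => if f x = k then (P x).toReal else 0) n κ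
    simp only [p, map_apply_toReal]
    rw [← this]
    refine sum_congr rfl fun x _ => ?_
    by_cases h : f ∘ x = κ
    · rw [if_pos h, wordLaw]
      exact prod_congr rfl fun i _ => (if_pos (congrFun h i)).symm
    · obtain ⟨i, hi⟩ := Function.ne_iff.1 h
      rw [if_neg h]
      exact (prod_eq_zero (mem_univ i) (if_neg hi)).symm
  have hpush : ∀ F : (Fin n → K) → ℝ, ∑ x, π x * F (f ∘ x) = ∑ κ, p κ * F κ := fun F => by
    rw [sum_mul_comp_eq π (fun x => f ∘ x) F]
    exact sum_congr rfl fun κ _ => by rw [hpπ]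
  obtain ⟨C, δ, S, hC0, hC1, hCm, hS, hδ⟩ := exists_uniformizing_kernel hp0 hp1 m
  have hm0 : (m : ℝ) ≠ 0 := NeZero.ne _
  have henc : ∀ s, ∃ e : PMF (Fin n → X), ∀ x, (e x).toReal = m * (π x * C (f ∘ x) s) :=
    fun s => exists_pmf_toReal_eq
      (fun x => mul_nonneg (Nat.cast_nonneg m) (mul_nonneg (hπ0 x) (hC0 _ s)))
      (by rw [← mul_sum, hpush fun κ => C κ s, hCm, mul_inv_cancel₀ hm0])
  choose e he using henc
  refine ⟨⟨e, fun y => PMF.pure (δ (g ∘ y))⟩, ?_, ?_⟩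
  · ext x
    rw [← ENNReal.toReal_eq_toReal_iff' (PMF.apply_ne_top _ _) (PMF.apply_ne_top _ _),
      Code.inputLaw_apply_toReal, productLaw_apply_toReal]
    simp only [he, inv_mul_cancel_left₀ hm0]
    rw [← mul_sum, hC1, mul_one]
  · have hsucc : (Code.successProb ⟨e, fun y => PMF.pure (δ (g ∘ y))⟩ W).toReal =
        ∑ κ, p κ * C κ (δ κ) := by
      rw [Code.successProb_toReal, sum_comm, ← hpush fun κ => C κ (δ κ)]
      refine sum_congr rfl fun x _ => ?_
      rw [sum_comm]
      have h1 : ∀ y : Fin n → Y, ∑ s, (m : ℝ)⁻¹ * (e s x).toReal *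
          (∏ i, (W (x i) (y i)).toReal) * (PMF.pure (δ (g ∘ y)) s).toReal =
          π x * C (f ∘ x) (δ (f ∘ x)) * ∏ i, (W (x i) (y i)).toReal := fun y => by
        simp only [he, inv_mul_cancel_left₀ hm0, PMF.pure_apply]
        -- Off the support f∘x and g∘y may differ, but both sides vanish.
        by_cases hz : π x * ∏ i, (W (x i) (y i)).toReal = 0
        · rw [mul_right_comm, hz, zero_mul]
          refine sum_eq_zero fun s _ => ?_
          rw [mul_right_comm (π x), hz, zero_mul, zero_mul]
        · have hxy : f ∘ x = g ∘ y := by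
            funext i
            obtain ⟨h1, h2⟩ := mul_ne_zero_iff.1 hz
            refine hfg _ _ (fun h => ?_) (fun h => ?_)
            · exact prod_ne_zero_iff.1 h1 i (mem_univ i) (by rw [h, ENNReal.toReal_zero])
            · exact prod_ne_zero_iff.1 h2 i (mem_univ i) (by rw [h, ENNReal.toReal_zero])
          rw [hxy, sum_eq_single (δ (g ∘ y))]
          · simp
          · intro s _ hs
            simp [hs]
          · simp
      rw [sum_congr rfl fun y _ => h1 y, ← mul_sum]
      have h2 : ∑ y : Fin n → Y, ∏ i, (W (x i) (y i)).toReal = 1 := by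
        rw [← sum_toReal_eq_one (productLaw fun i => W (x i))]
        exact sum_congr rfl fun y _ => (productLaw_apply_toReal _ y).symm
      rw [h2, mul_one]
    rw [hsucc]
    have h1 : 1 - ∑ κ ∈ S, p κ ≤ ∑ κ, p κ * C κ (δ κ) := by
      rw [← hp1, ← sum_add_sum_compl S, add_sub_cancel_left]
      calc ∑ κ ∈ Sᶜ, p κ = ∑ κ ∈ Sᶜ, p κ * C κ (δ κ) :=
            sum_congr rfl fun κ hκ => by rw [hδ κ (mem_compl.1 hκ), mul_one]
        _ ≤ _ := sum_le_univ_sum_of_nonneg fun κ => mul_nonneg (hp0 κ) (hC0 _ _)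
    have h2 := sum_le_card_mul_add_rpow hp0 S hτ ht
    have h3 : ∑ κ, p κ ^ (1 + t) = (∑ k, ((P.map f) k).toReal ^ (1 + t)) ^ n := by
      rw [← Fin.prod_const,
        Fintype.prod_sum (fun (_ : Fin n) k => ((P.map f) k).toReal ^ (1 + t))]
      exact sum_congr rfl fun κ _ =>
        (Real.finsetProd_rpow _ _ (fun i _ => ENNReal.toReal_nonneg) _).symm
    have h4 : (#S : ℝ) * τ ≤ m * τ := mul_le_mul_of_nonneg_right (Nat.cast_le.2 hS) hτ.le
    rw [h3] at h2
    linarith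

theorem achievable_of_lt_entropy {X Y K : Type*} [Fintype X] [Fintype Y] [Fintype K]
    {P : PMF X} {W : X → PMF Y} {f : X → K} {g : Y → K}
    (hfg : ∀ x y, P x ≠ 0 → W x y ≠ 0 → f x = g y) {R : ℝ≥0}
    (hR : (R : ℝ) < entropy (P.map f)) : Achievable P W R := by
  -- The threshold τ = e^(-nR') with R < R' < H makes both error terms geometric: mτ ≤ e^(-n(R'-R)),
  -- and the other is the n-th power of a number below 1.
  obtain ⟨R', hRR, hR'⟩ := exists_between hR
  obtain ⟨t, ht, hG⟩ := exists_sum_rpow_lt_of_lt_entropy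
    (fun i => ENNReal.toReal_nonneg) (sum_toReal_eq_one (P.map f)) hR'
  choose c hc hsucc using fun n => exists_code_of_common_function hfg n (numMessages n R)
    (Real.exp_pos (-(n * R'))) ht
  refine ⟨c, hc, ?_⟩
  have hlow : ∀ n : ℕ, 1 - (Real.exp (-(R' - R)) ^ n +
      ((∑ k, ((P.map f) k).toReal ^ (1 + t)) * Real.exp (t * R')) ^ n) ≤
      ((c n).successProb W).toReal := fun n => by
    refine le_trans (sub_le_sub_left (add_le_add ?_ (le_of_eq ?_)) 1) (hsucc n)
    · have h1 : (numMessages n R : ℝ) ≤ Real.exp (n * R) := Nat.floor_le (Real.exp_pos _).le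
      refine (mul_le_mul_of_nonneg_right h1 (Real.exp_pos _).le).trans_eq ?_
      rw [← Real.exp_add, ← Real.exp_nat_mul]
      congr 1
      ring
    · rw [← Real.exp_mul, mul_pow, ← Real.exp_nat_mul, mul_comm,
        show -(n * R') * -t = n * (t * R') by ring]
  have hG0 : 0 ≤ (∑ k, ((P.map f) k).toReal ^ (1 + t)) * Real.exp (t * R') :=
    mul_nonneg (sum_nonneg fun k _ => Real.rpow_nonneg ENNReal.toReal_nonneg _)
      (Real.exp_pos _).le
  have hlim : Tendsto (fun n : ℕ => 1 - (Real.exp (-(R' - R)) ^ n +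
      ((∑ k, ((P.map f) k).toReal ^ (1 + t)) * Real.exp (t * R')) ^ n)) atTop
      (𝓝 (1 - (0 + 0))) :=
    ((tendsto_pow_atTop_nhds_zero_of_lt_one (Real.exp_pos _).le
      (Real.exp_lt_one_iff.2 (by linarith))).add
      (tendsto_pow_atTop_nhds_zero_of_lt_one hG0 hG)).const_sub 1
  have htop : ∀ n, (c n).successProb W ≠ ⊤ := fun n =>
    ne_top_of_le_ne_top ENNReal.one_ne_top ((c n).successProb_le_one W)
  rw [← ENNReal.tendsto_toReal_iff htop ENNReal.one_ne_top, ENNReal.toReal_one]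
  rw [add_zero, sub_zero] at hlim
  refine tendsto_of_tendsto_of_tendsto_of_le_of_le hlim tendsto_const_nhds hlow fun n => ?_
  exact ENNReal.toReal_le_of_le_ofReal zero_le_one
    (by simpa using (c n).successProb_le_one W)

theorem achievable_zero {X Y : Type*} [Fintype X] [Fintype Y] (P : PMF X) (W : X → PMF Y) :
    Achievable P W 0 := by
  have hm : ∀ n, numMessages n 0 = 1 := fun n => by simp [numMessages]
  let c : ∀ n, Code X Y n (numMessages n 0) := fun n =>
    ⟨fun _ => productLaw fun _ => P, fun _ => PMF.pure 0⟩
  refine ⟨c, fun n => ?_, ?_⟩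
  · rw [Code.inputLaw_eq]
    exact PMF.bind_const _ _
  · have : ∀ n, (c n).successProb W = 1 := fun n => by
      have : Subsingleton (Fin (numMessages n 0)) := by rw [hm]; infer_instance
      rw [Code.successProb, PMF.toOuterMeasure_apply_eq_one_iff]
      exact fun ω _ => Subsingleton.elim _ _
    simp only [this]
    exact tendsto_const_nhds

/-! ### Capacity and common information -/

/-- Only values in the image of f contribute, each at most 1. The bound does not depend on k, so it
bounds all common-part entropies at once. -/
theorem entropy_map_le {X : Type*} [Fintype X] {k : ℕ} (P : PMF X) (f : X → Fin k) :
    entropy (P.map f) ≤ Fintype.card X := by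
  classical
  have h : ∀ i, i ∉ univ.image f → Real.negMulLog ((P.map f) i).toReal = 0 := fun i hi => by
    have : (P.map f) i = 0 := by
      rw [PMF.apply_eq_zero_iff, PMF.mem_support_map_iff]
      rintro ⟨x, -, hx⟩
      exact hi (mem_image.2 ⟨x, mem_univ x, hx⟩)
    rw [this, ENNReal.toReal_zero, Real.negMulLog_zero]
  rw [entropy, ← sum_subset (subset_univ (univ.image f)) fun i _ hi => h i hi]
  calc _ ≤ ∑ i ∈ univ.image f, (1 : ℝ) := sum_le_sum fun i _ => by
        have := Real.negMulLog_le_one_sub_self (x := ((P.map f) i).toReal) ENNReal.toReal_nonneg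
        have h0 : 0 ≤ ((P.map f) i).toReal := ENNReal.toReal_nonneg
        linarith
    _ ≤ _ := by
      rw [sum_const, nsmul_eq_mul, mul_one]
      exact Nat.cast_le.2 card_image_le

end ChannelCapacity

theorem mainTheorem10 {X Y : Type*} [Fintype X] [Fintype Y] (P : PMF X) (W : X → PMF Y) :
    IsLUB (ChannelCapacity.achievableRates P W) (ChannelCapacity.capacity P W) ∧
      IsLUB (ChannelCapacity.commonPartEntropies (ChannelCapacity.inputOutputLaw P W))
        (ChannelCapacity.gacsKorner (ChannelCapacity.inputOutputLaw P W)) ∧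
      ChannelCapacity.capacity P W =
        ChannelCapacity.gacsKorner (ChannelCapacity.inputOutputLaw P W) := by
  open ChannelCapacity in
  obtain ⟨k, f, g, hfg, hmax⟩ := exists_maximal_common_function fun x y => P x ≠ 0 ∧ W x y ≠ 0
  have hmem : entropy (P.map f) ∈ commonPartEntropies (inputOutputLaw P W) :=
    ⟨k, f, g, fun z hz => hfg _ _ ((mem_support_inputOutputLaw P W z).1 hz),
      by rw [map_inputOutputLaw]⟩
  have hGK : IsLUB (commonPartEntropies (inputOutputLaw P W)) (gacsKorner (inputOutputLaw P W)) := by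
    refine isLUB_csSup ⟨_, hmem⟩ ⟨Fintype.card X, ?_⟩
    rintro _ ⟨k, f, g, -, rfl⟩
    rw [map_inputOutputLaw]
    exact entropy_map_le P f
  have hub : ∀ r ∈ achievableRates P W, r ≤ entropy (P.map f) := by
    rintro _ ⟨R, rfl, hR⟩
    exact hR.le_entropy hmax
  have hzero : (0 : ℝ) ∈ achievableRates P W := ⟨0, rfl, achievable_zero P W⟩
  have hC : IsLUB (achievableRates P W) (capacity P W) := isLUB_csSup ⟨_, hzero⟩ ⟨_, hub⟩
  refine ⟨hC, hGK, le_antisymm ((hC.2 hub).trans (hGK.1 hmem)) (hGK.2 ?_)⟩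
  rintro _ ⟨k, f, g, hfg, rfl⟩
  rw [map_inputOutputLaw]
  refine le_of_forall_lt fun r hr => ?_
  obtain ⟨r', hr, hr'⟩ := exists_between hr
  -- Rates are nonnegative, so a negative r' is handled by the achievable rate 0.
  rcases lt_or_ge r' 0 with h | h
  · exact (hr.trans h).trans_le (hC.1 hzero)
  · refine hr.trans_le (hC.1 ⟨⟨r', h⟩, rfl, achievable_of_lt_entropy (f := f) (g := g) ?_ hr'⟩)
    exact fun x y hx hy => hfg (x, y) ((mem_support_inputOutputLaw P W _).2 ⟨hx, hy⟩)
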